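/- Let $0<v_{min}<v_{max}$, $\kappa\ge 0$, $\theta,v_0\in[v_{min},v_{max}]$, $\sigma,\delta,x_0\in\mathbb R$, $r>0$, $\rho^2<1$, $T>0$, and let $(V,X)$ be a solution on $[0,T]$, with values in $[v_{min},v_{max}]\times\mathbb R$ and $(V_0,X_0)=(v_0,x_0)$, of the stochastic volatility Jacobi model $$dV_t=\kappa(\theta-V_t)\,dt+\sigma\sqrt{Q(V_t)}\,dW_t,\qquad dX_t=(r-\delta-V_t/2)\,dt+\rho\sqrt{Q(V_t)}\,dW_t+\sqrt{V_t-\rho^2Q(V_t)}\,dW_t^{\perp},$$ where $Q(v)=\frac{(v-v_{min})(v_{max}-v)}{(\sqrt{v_{max}}-\sqrt{v_{min}})^2}$ and $W,W^\perp$ are independent standard Brownian motions (solutions are understood in the weak sense, i.e. through the associated martingale problem). Let $w$ be the Gaussian density with mean $\mu_w\in\mathbb R$ and variance $\sigma_w^2>v_{max}T/2$, let $H_n(x)=\frac1{\sqrt{n!}}\mathcal H_n\!\left(\frac{x-\mu_w}{\sigma_w}\right)$ with $\mathcal H_n$ the probabilists' Hermite polynomials, and let $\ell_n=\mathbb E[H_n(X_T)]$.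 Fix an integer $M>0$ and put $$g_T^{(M)}(x)=\sum_{n=0}^M \ell_n H_n(x)w(x),\qquad x\in\mathbb R.$$ Assume that $g_T^{(M)}\ge 0$, so that it is a probability density, and let $X_T^{(M)}$ be a random variable with this density. For each $N\ge1$ let $\Gamma_N=\{x_1,\dots,x_N\}$ be an optimal quadratic quantizer of $X_T^{(M)}$, i.e. $N$ distinct points minimizing $(y_1,\dots,y_N)\mapsto \mathbb E\big[\min_{1\le i\le N}|X_T^{(M)}-y_i|^2\big]$ over $\mathbb R^N$, and let $(C_i(\Gamma_N))_{1\le i\le N}$ be an associated Voronoi partition, i.e. a Borel partition of $\mathbb R$ with $C_i(\Gamma_N)\subset\{\xi:|\xi-x_i|=\min_j|\xi-x_j|\}$. For a strike $K\in\mathbb R$ let $$\mathrm{err}^2_{M,N}=\left|e^{-rT}\int_{\mathbb R}(e^x-K)^+g_T^{(M)}(x)\,dx-e^{-rT}\sum_{i=1}^N\int_{C_i(\Gamma_N)}(e^{x_i}-K)^+g_T^{(M)}(x)\,dx\right|$$ (the superscript $2$ is an index, not a square). Then $S_T^{(M)}=e^{X_T^{(M)}}$ has density $h_T^{(M)}(s)=g_T^{(M)}(\ln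 s)/s$ on $(0,\infty)$, the quantity $\|h_T^{(M)}\|_{1/3}=\left(\int_0^\infty h_T^{(M)}(s)^{1/3}\,ds\right)^{3}$ is finite, and $\lim_{N\to\infty}N\,\mathrm{err}^2_{M,N}$ exists and satisfies $$\lim_{N\to\infty}N\,\mathrm{err}^2_{M,N}\le\frac{\|h_T^{(M)}\|_{1/3}^{1/2}}{2\sqrt3}.$$ -/

import Mathlib

open MeasureTheory ProbabilityTheory Filter Topology
open scoped NNReal ENNReal

noncomputable section

namespace SVJ

/-! ### The stochastic volatility Jacobi model -/

/-- The parameters of the stochastic volatility Jacobi model. -/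
structure Params where
  vmin : ℝ
  vmax : ℝ
  κ : ℝ
  θ : ℝ
  σ : ℝ
  ρ : ℝ
  r : ℝ
  δ : ℝ
  v₀ : ℝ
  x₀ : ℝ

/-- The standing restrictions on the parameters. -/
structure Params.Admissible (p : Params) : Prop where
  vmin_pos : 0 < p.vmin
  vmin_lt_vmax : p.vmin < p.vmax
  κ_nonneg : 0 ≤ p.κ
  θ_mem : p.θ ∈ Set.Icc p.vmin p.vmax
  ρ_sq_lt_one : p.ρ ^ 2 < 1
  r_pos : 0 < p.r
  v₀_mem : p.v₀ ∈ Set.Icc p.vmin p.vmax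

/-- `Q(v) = (v - vmin) (vmax - v) / (√vmax - √vmin)²`. -/
def Params.Q (p : Params) (v : ℝ) : ℝ :=
  (v - p.vmin) * (p.vmax - v) / (√p.vmax - √p.vmin) ^ 2

/-- Partial derivative in the first variable. -/
def dv (f : ℝ × ℝ → ℝ) (y : ℝ × ℝ) : ℝ := fderiv ℝ f y (1, 0)

/-- Partial derivative in the second variable. -/
def dx (f : ℝ × ℝ → ℝ) (y : ℝ × ℝ) : ℝ := fderiv ℝ f y (0, 1)

/-- The generator `b(v)ᵀ ∇f + ½ Tr (a(v) ∇²f)` of the model, evaluated at `y = (v, x)`, where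
`b(v) = (κ(θ - v), r - δ - v/2)` and `a(v) = [[σ² Q(v), ρσ Q(v)], [ρσ Q(v), v]]`. -/
def Params.generator (p : Params) (f : ℝ × ℝ → ℝ) (y : ℝ × ℝ) : ℝ :=
  p.κ * (p.θ - y.1) * dv f y + (p.r - p.δ - y.1 / 2) * dx f y
    + 1 / 2 * (p.σ ^ 2 * p.Q y.1 * dv (dv f) y + 2 * (p.ρ * p.σ * p.Q y.1 * dv (dx f) y)
        + y.1 * dx (dx f) y)

/-- `(V, X)` is a (weak) solution on `[0, T]`, with values in `[vmin, vmax] × ℝ`, of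
`dV = κ(θ - V) dt + σ √Q(V) dW`,
`dX = (r - δ - V/2) dt + ρ √Q(V) dW + √(V - ρ² Q(V)) dW^⊥`, `(V₀, X₀) = (v₀, x₀)`,
in the sense of the martingale problem for the generator.
Only the values of `V` and `X` at times in `[0, T]` matter. -/
structure IsSolution (p : Params) (T : ℝ) {Ω : Type*} {mΩ : MeasurableSpace Ω}
    (ℱ : Filtration (Set.Icc (0 : ℝ) T) mΩ) (P : Measure Ω) (V X : ℝ → Ω → ℝ) : Prop where
  adapted_V : ∀ t : Set.Icc (0 : ℝ) T, Measurable[ℱ t] (V t)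
  adapted_X : ∀ t : Set.Icc (0 : ℝ) T, Measurable[ℱ t] (X t)
  continuous_V : ∀ᵐ ω ∂P, ContinuousOn (fun t => V t ω) (Set.Icc 0 T)
  continuous_X : ∀ᵐ ω ∂P, ContinuousOn (fun t => X t ω) (Set.Icc 0 T)
  init_V : ∀ᵐ ω ∂P, V 0 ω = p.v₀
  init_X : ∀ᵐ ω ∂P, X 0 ω = p.x₀
  range_V : ∀ᵐ ω ∂P, ∀ t ∈ Set.Icc (0 : ℝ) T, V t ω ∈ Set.Icc p.vmin p.vmax
  martingale : ∀ f : ℝ × ℝ → ℝ, ContDiff ℝ ((⊤ : ℕ∞) : WithTop ℕ∞) f → HasCompactSupport f →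
    Martingale (fun (t : Set.Icc (0 : ℝ) T) ω =>
      f (V t ω, X t ω) - ∫ s in (0 : ℝ)..t, p.generator f (V s ω, X s ω)) ℱ P

/-! ### The truncated Hermite expansion of the density -/

/-- The Gaussian weight: the density of the normal law with mean `μw` and variance `σw²`. -/
def weight (μw : ℝ) (σw : ℝ≥0) (x : ℝ) : ℝ := gaussianPDFReal μw (σw ^ 2) x

/-- The generalized Hermite polynomials, an orthonormal basis of `L²(w dx)`. -/
def genHermite (μw : ℝ) (σw : ℝ≥0) (n : ℕ) (x : ℝ) : ℝ :=
  1 / √(n.factorial : ℝ) * Polynomial.aeval ((x - μw) / σw) (Polynomial.hermite n)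

/-- The Hermite moment `ℓₙ = E[Hₙ(Y)]` of a random variable `Y`; it is `∫ Hₙ(x) g(x) dx` when `Y`
has density `g`. -/
def hermiteMoment {Ω : Type*} [MeasurableSpace Ω] (P : Measure Ω) (Y : Ω → ℝ)
    (μw : ℝ) (σw : ℝ≥0) (n : ℕ) : ℝ :=
  ∫ ω, genHermite μw σw n (Y ω) ∂P

/-- The truncated density `g^{(M)}(x) = ∑_{n ≤ M} ℓₙ Hₙ(x) w(x)`. -/
def truncDensity {Ω : Type*} [MeasurableSpace Ω] (P : Measure Ω) (Y : Ω → ℝ)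
    (μw : ℝ) (σw : ℝ≥0) (M : ℕ) (x : ℝ) : ℝ :=
  ∑ n ∈ Finset.range (M + 1),
    hermiteMoment P Y μw σw n * genHermite μw σw n x * weight μw σw x

/-- The law on `ℝ` with density `g`. -/
def densityLaw (g : ℝ → ℝ) : Measure ℝ := volume.withDensity fun x => ENNReal.ofReal (g x)

/-- `h(s) = g(ln s) / s`. -/
def expDensity (g : ℝ → ℝ) (s : ℝ) : ℝ := g (Real.log s) / s

/-! ### Optimal quadratic quantization -/

/-- The quadratic distortion `E[min_i |Y - x_i|²]` of the grid `x`, where `Y` has law `P`. -/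
def distortion (P : Measure ℝ) {N : ℕ} (x : Fin N → ℝ) : ℝ :=
  ∫ ξ, ⨅ i, |ξ - x i| ^ 2 ∂P

/-- `x` is an optimal quadratic quantizer (with pairwise distinct points) of the law `P`. -/
structure IsOptimalQuantizer (P : Measure ℝ) {N : ℕ} (x : Fin N → ℝ) : Prop where
  injective : Function.Injective x
  minimal : ∀ y : Fin N → ℝ, distortion P x ≤ distortion P y

/-- `C` is a Voronoi partition of `ℝ` associated with the grid `x`. -/
structure IsVoronoiPartition {N : ℕ} (x : Fin N → ℝ) (C : Fin N → Set ℝ) : Prop where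
  measurable : ∀ i, MeasurableSet (C i)
  disjoint : Pairwise fun i j => Disjoint (C i) (C j)
  cover : ⋃ i, C i = Set.univ
  nearest : ∀ i, ∀ ξ ∈ C i, ∀ j, |ξ - x i| ≤ |ξ - x j|

/-! ### Call prices -/

/-- Price of the call with strike `K` and maturity `T` when the log price has density `g`. -/
def callPrice (r T K : ℝ) (g : ℝ → ℝ) : ℝ :=
  Real.exp (-r * T) * ∫ x, max (Real.exp x - K) 0 * g x

/-- Call price when the log price with density `g` is quantized on the grid `x` with cells `C`. -/
def quantizedCallPrice (r T K : ℝ) (g : ℝ → ℝ) {N : ℕ} (x : Fin N → ℝ) (C : Fin N → Set ℝ) : ℝ :=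
  Real.exp (-r * T) * ∑ i, ∫ ξ in C i, max (Real.exp (x i) - K) 0 * g ξ

/-- The quantization error. -/
def quantError (r T K : ℝ) (g : ℝ → ℝ) {N : ℕ} (x : Fin N → ℝ) (C : Fin N → Set ℝ) : ℝ :=
  |callPrice r T K g - quantizedCallPrice r T K g x C|

end SVJ

end

/-!
A limit equal to `0` satisfies the bound, and it is `0` for every density with an exponential moment
of order `4`. Write `Ŷ` for the projection of `Y` on an optimal grid of `N` points. Perturbing the
grid shows that it is stationary: `E[c(Ŷ) (Y - Ŷ)] = 0` for every function `c`. If `c` is a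
subgradient of the convex payoff `f`, then `f(Y) - f(Ŷ) - c(Ŷ) (Y - Ŷ)` lies between `0` and
`(c(Y) - c(Ŷ)) (Y - Ŷ)`, so stationarity and the Cauchy-Schwarz inequality give
`|E[f(Y)] - E[f(Ŷ)]| ≤ ‖c(Y) - c(Ŷ)‖₂ ‖Y - Ŷ‖₂`. The second factor is `O(1 / N)` by comparison with
an explicit grid. The first tends to `0`, because `c` is monotone, hence continuous outside a
countable set, which is null for `Y`.
-/

namespace SVJ

/-! ### Voronoi projections -/

/-- The nearest-point projection onto the grid `x` determined by the partition `C`. It is written as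
a sum of indicators so that its composition with any function is visibly a step function. -/
noncomputable def voronoiProj {N : ℕ} (x : Fin N → ℝ) (C : Fin N → Set ℝ) (ξ : ℝ) : ℝ :=
  ∑ i, (C i).indicator (fun _ => x i) ξ

section Voronoi

variable {N : ℕ} {x : Fin N → ℝ} {C : Fin N → Set ℝ} {μ : Measure ℝ}

namespace IsVoronoiPartition

theorem exists_mem (hC : IsVoronoiPartition x C) (ξ : ℝ) : ∃ i, ξ ∈ C i :=
  Set.iUnion_eq_univ_iff.1 hC.cover ξ

theorem sum_indicator_eq (hC : IsVoronoiPartition x C) (a : Fin N → ℝ) {i : Fin N} {ξ : ℝ}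
    (hξ : ξ ∈ C i) : ∑ j, (C j).indicator (fun _ => a j) ξ = a i := by
  rw [Finset.sum_eq_single_of_mem i (Finset.mem_univ i), Set.indicator_of_mem hξ]
  exact fun j _ hj =>
    Set.indicator_of_notMem (fun h => Set.disjoint_left.1 (hC.disjoint hj) h hξ) _

theorem voronoiProj_eq (hC : IsVoronoiPartition x C) {i : Fin N} {ξ : ℝ} (hξ : ξ ∈ C i) :
    voronoiProj x C ξ = x i :=
  hC.sum_indicator_eq x hξ

theorem measurable_comp_voronoiProj (hC : IsVoronoiPartition x C) (c : ℝ → ℝ) :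
    Measurable fun ξ => c (voronoiProj x C ξ) := by
  have hsum : (fun ξ => c (voronoiProj x C ξ)) =
      fun ξ => ∑ i, (C i).indicator (fun _ => c (x i)) ξ := by
    funext ξ
    obtain ⟨i, hi⟩ := hC.exists_mem ξ
    rw [hC.voronoiProj_eq hi, hC.sum_indicator_eq (fun i => c (x i)) hi]
  rw [hsum]
  exact Finset.measurable_fun_sum _ fun i _ => measurable_const.indicator (hC.measurable i)

theorem exists_abs_comp_voronoiProj_le (hC : IsVoronoiPartition x C) (c : ℝ → ℝ) :
    ∃ B, ∀ ξ, |c (voronoiProj x C ξ)| ≤ B := by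
  refine ⟨∑ i, |c (x i)|, fun ξ => ?_⟩
  obtain ⟨i, hi⟩ := hC.exists_mem ξ
  rw [hC.voronoiProj_eq hi]
  exact Finset.single_le_sum (f := fun i => |c (x i)|) (fun _ _ => abs_nonneg _)
    (Finset.mem_univ i)

theorem memLp_comp_voronoiProj [IsFiniteMeasure μ] (hC : IsVoronoiPartition x C) (c : ℝ → ℝ)
    (p : ℝ≥0∞) : MemLp (fun ξ => c (voronoiProj x C ξ)) p μ := by
  obtain ⟨B, hB⟩ := hC.exists_abs_comp_voronoiProj_le c
  exact .of_bound (hC.measurable_comp_voronoiProj c).aestronglyMeasurable B (.of_forall hB)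

theorem memLp_sub_voronoiProj [IsFiniteMeasure μ] (hC : IsVoronoiPartition x C) {p : ℝ≥0∞}
    (hμ : MemLp (fun ξ : ℝ => ξ) p μ) : MemLp (fun ξ => ξ - voronoiProj x C ξ) p μ :=
  hμ.sub (hC.memLp_comp_voronoiProj (fun η => η) p)

theorem abs_sub_voronoiProj_le (hC : IsVoronoiPartition x C) (ξ η : ℝ) :
    |ξ - voronoiProj x C ξ| ≤ |ξ - voronoiProj x C η| := by
  obtain ⟨i, hi⟩ := hC.exists_mem ξ
  obtain ⟨j, hj⟩ := hC.exists_mem η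
  rw [hC.voronoiProj_eq hi, hC.voronoiProj_eq hj]
  exact hC.nearest i ξ hi j

theorem abs_voronoiProj_le (hC : IsVoronoiPartition x C) (ξ η : ℝ) :
    |voronoiProj x C ξ| ≤ 2 * |ξ| + |voronoiProj x C η| := by
  have hξ : |voronoiProj x C ξ| ≤ |ξ| + |ξ - voronoiProj x C ξ| := by
    simpa using abs_sub ξ (ξ - voronoiProj x C ξ)
  linarith [hC.abs_sub_voronoiProj_le ξ η, abs_sub ξ (voronoiProj x C η)]

theorem iInf_abs_sub_sq_eq (hC : IsVoronoiPartition x C) (ξ : ℝ) :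
    ⨅ i, |ξ - x i| ^ 2 = (ξ - voronoiProj x C ξ) ^ 2 := by
  obtain ⟨i, hi⟩ := hC.exists_mem ξ
  have : Nonempty (Fin N) := ⟨i⟩
  rw [hC.voronoiProj_eq hi, ← sq_abs]
  exact le_antisymm (ciInf_le (Set.finite_range _).bddBelow i)
    (le_ciInf fun j => pow_le_pow_left₀ (abs_nonneg _) (hC.nearest i ξ hi j) 2)

theorem distortion_eq (hC : IsVoronoiPartition x C) (μ : Measure ℝ) :
    distortion μ x = ∫ ξ, (ξ - voronoiProj x C ξ) ^ 2 ∂μ :=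
  integral_congr_ae (.of_forall hC.iInf_abs_sub_sq_eq)

theorem sum_setIntegral_mul_eq (hC : IsVoronoiPartition x C) {g : ℝ → ℝ} (hg : Integrable g μ)
    (f : ℝ → ℝ) : ∑ i, ∫ ξ in C i, f (x i) * g ξ ∂μ = ∫ ξ, f (voronoiProj x C ξ) * g ξ ∂μ := by
  obtain ⟨B, hB⟩ := hC.exists_abs_comp_voronoiProj_le f
  have hint : Integrable (fun ξ => f (voronoiProj x C ξ) * g ξ) μ :=
    hg.bdd_mul (hC.measurable_comp_voronoiProj f).aestronglyMeasurable (.of_forall hB)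
  rw [← setIntegral_univ (μ := μ), ← hC.cover,
    integral_iUnion_fintype hC.measurable hC.disjoint fun _ => hint.integrableOn]
  refine Finset.sum_congr rfl fun i _ => setIntegral_congr_fun (hC.measurable i) fun ξ hξ => ?_
  rw [hC.voronoiProj_eq hξ]

/-- Markov's inequality: near a point which is `2 ε`-far from the grid, all points are `ε`-far. -/
theorem sq_mul_measureReal_ball_le_distortion [IsFiniteMeasure μ] (hC : IsVoronoiPartition x C)
    (hμ : MemLp (fun ξ : ℝ => ξ) 2 μ) {ξ ε : ℝ} (hε : 0 ≤ ε)
    (hξ : 2 * ε ≤ |ξ - voronoiProj x C ξ|) :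
    ε ^ 2 * μ.real (Metric.ball ξ ε) ≤ distortion μ x := by
  have hfar : Metric.ball ξ ε ⊆ {η | ε ^ 2 ≤ (η - voronoiProj x C η) ^ 2} := by
    intro η hη
    rw [Metric.mem_ball', Real.dist_eq] at hη
    have htri := abs_sub_le ξ η (voronoiProj x C η)
    have hnear := hC.abs_sub_voronoiProj_le ξ η
    rw [Set.mem_ofPred_eq, ← sq_abs (η - _)]
    exact pow_le_pow_left₀ hε (by linarith) 2
  rw [hC.distortion_eq]
  exact (mul_le_mul_of_nonneg_left (measureReal_mono hfar) (sq_nonneg ε)).trans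
    (mul_meas_ge_le_integral_of_nonneg (.of_forall fun _ => sq_nonneg _)
      (hC.memLp_sub_voronoiProj hμ).integrable_sq _)

end IsVoronoiPartition

/-! ### Optimal quantizers -/

theorem distortion_nonneg (μ : Measure ℝ) (x : Fin N → ℝ) : 0 ≤ distortion μ x :=
  integral_nonneg fun _ => Real.iInf_nonneg fun _ => by positivity

theorem distortion_le_integral {F : ℝ → ℝ} (hF : Integrable F μ)
    (hx : ∀ ξ, ∃ i, (ξ - x i) ^ 2 ≤ F ξ) : distortion μ x ≤ ∫ ξ, F ξ ∂μ := by
  refine integral_mono_of_nonneg (.of_forall fun ξ => Real.iInf_nonneg fun _ => by positivity) hF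
    (.of_forall fun ξ => ?_)
  obtain ⟨i, hi⟩ := hx ξ
  exact (ciInf_le (Set.finite_range _).bddBelow i).trans ((sq_abs _).trans_le hi)

theorem IsOptimalQuantizer.integral_comp_mul_sub_eq_zero [IsFiniteMeasure μ]
    (hx : IsOptimalQuantizer μ x) (hC : IsVoronoiPartition x C)
    (hμ : MemLp (fun ξ : ℝ => ξ) 2 μ) (c : ℝ → ℝ) :
    ∫ ξ, c (voronoiProj x C ξ) * (ξ - voronoiProj x C ξ) ∂μ = 0 := by
  have hsub := hC.memLp_sub_voronoiProj hμ
  have hcomp := hC.memLp_comp_voronoiProj (μ := μ) c 2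
  set π := voronoiProj x C with hπ
  set A := ∫ ξ, c (π ξ) * (ξ - π ξ) ∂μ
  set B := ∫ ξ, c (π ξ) ^ 2 ∂μ
  have hexpand (t : ℝ) : ∫ ξ, (ξ - π ξ - t * c (π ξ)) ^ 2 ∂μ
      = B * (t * t) + -2 * A * t + distortion μ x := by
    have hsq (ξ : ℝ) : (ξ - π ξ - t * c (π ξ)) ^ 2
        = t * t * c (π ξ) ^ 2 + -2 * t * (c (π ξ) * (ξ - π ξ)) + (ξ - π ξ) ^ 2 := by ring
    have hint₁ : Integrable (fun ξ => t * t * c (π ξ) ^ 2) μ := hcomp.integrable_sq.const_mul _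
    have hint₂ : Integrable (fun ξ => -2 * t * (c (π ξ) * (ξ - π ξ))) μ :=
      (hcomp.integrable_mul hsub).const_mul _
    simp only [hsq]
    rw [integral_add (f := fun ξ => t * t * c (π ξ) ^ 2 + -2 * t * (c (π ξ) * (ξ - π ξ)))
      (hint₁.add hint₂) hsub.integrable_sq, integral_add hint₁ hint₂, integral_const_mul,
      integral_const_mul, hC.distortion_eq]
    ring
  have hquad (t : ℝ) : 0 ≤ B * (t * t) + -2 * A * t + 0 := by
    -- Moving each point `x i` to `x i + t * c (x i)` does not decrease the distortion.
    have hperturb : distortion μ (fun i => x i + t * c (x i))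
        ≤ ∫ ξ, (ξ - π ξ - t * c (π ξ)) ^ 2 ∂μ := by
      refine distortion_le_integral (hsub.sub (hcomp.const_mul t)).integrable_sq fun ξ => ?_
      obtain ⟨i, hi⟩ := hC.exists_mem ξ
      exact ⟨i, by rw [hπ, hC.voronoiProj_eq hi, sub_sub]⟩
    linarith [hx.minimal fun i => x i + t * c (x i), hexpand t]
  have hdiscrim := discrim_le_zero hquad
  rw [discrim] at hdiscrim
  nlinarith [sq_nonneg A]

end Voronoi

/-- The points `j / (m - j)` are the images of the equidistant points `j / m` under the inverse of
`ξ ↦ ξ / (1 + ξ)`. -/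
theorem exists_abs_sub_div_le {m : ℕ} (hm : 0 < m) {ξ : ℝ} (hξ : 0 ≤ ξ) :
    ∃ j < m, |ξ - (j : ℝ) / (m - j)| ≤ (1 + ξ) ^ 2 / m := by
  have hm₀ : (0 : ℝ) < m := by exact_mod_cast hm
  have ha : (m * ξ / (1 + ξ)) * (1 + ξ) = m * ξ := by field_simp
  set a : ℝ := m * ξ / (1 + ξ)
  have ha₀ : 0 ≤ a := by positivity
  have ham : a < m := by nlinarith
  refine ⟨⌊a⌋₊, (Nat.floor_lt ha₀).2 ham, ?_⟩
  have hja : (⌊a⌋₊ : ℝ) ≤ a := Nat.floor_le ha₀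
  have haj : a - ⌊a⌋₊ ≤ 1 := by linarith [Nat.lt_floor_add_one a]
  set j : ℝ := (⌊a⌋₊ : ℝ)
  have hmj : 0 < m - j := by linarith
  have hdiff : ξ - j / (m - j) = (a - j) * ((1 + ξ) / (m - j)) := by
    field_simp
    linarith
  have hgap : (1 + ξ) / (m - j) ≤ (1 + ξ) ^ 2 / m := by
    rw [div_le_div_iff₀ hmj hm₀]
    nlinarith
  rw [hdiff, abs_of_nonneg (mul_nonneg (sub_nonneg.2 hja) (by positivity))]
  exact (mul_le_of_le_one_left (by positivity) haj).trans hgap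

theorem exists_grid_abs_sub_le {m N : ℕ} (hm : 0 < m) (hN : 2 * m ≤ N) :
    ∃ y : Fin N → ℝ, ∀ ξ, ∃ i, |ξ - y i| ≤ (1 + |ξ|) ^ 2 / m := by
  refine ⟨fun i => if (i : ℕ) < m then (i : ℕ) / ((m : ℝ) - (i : ℕ))
    else -(((i - m : ℕ) : ℝ) / ((m : ℝ) - ((i - m : ℕ) : ℝ))), fun ξ => ?_⟩
  obtain ⟨j, hj, hξj⟩ := exists_abs_sub_div_le hm (abs_nonneg ξ)
  rcases le_total 0 ξ with hξ | hξ
  · refine ⟨⟨j, by omega⟩, ?_⟩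
    rw [abs_of_nonneg hξ] at hξj ⊢
    simpa [hj] using hξj
  · refine ⟨⟨m + j, by omega⟩, ?_⟩
    rw [abs_of_nonpos hξ] at hξj ⊢
    rw [← abs_neg]
    simpa [add_comm, sub_eq_add_neg] using hξj

theorem IsOptimalQuantizer.sq_mul_distortion_le {μ : Measure ℝ}
    (hμ : Integrable (fun ξ : ℝ => (1 + |ξ|) ^ 4) μ) {N : ℕ} (hN : 2 ≤ N) {x : Fin N → ℝ}
    (hx : IsOptimalQuantizer μ x) :
    (N : ℝ) ^ 2 * distortion μ x ≤ 9 * ∫ ξ, (1 + |ξ|) ^ 4 ∂μ := by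
  obtain ⟨m, hm, hmN, hNm⟩ : ∃ m, 0 < m ∧ 2 * m ≤ N ∧ N ≤ 3 * m :=
    ⟨N / 2, by omega, by omega, by omega⟩
  obtain ⟨y, hy⟩ := exists_grid_abs_sub_le hm hmN
  have hgrid : distortion μ y ≤ ∫ ξ, 1 / (m : ℝ) ^ 2 * (1 + |ξ|) ^ 4 ∂μ := by
    refine distortion_le_integral (hμ.const_mul _) fun ξ => ?_
    obtain ⟨i, hi⟩ := hy ξ
    refine ⟨i, (sq_le_sq' (neg_le_of_abs_le hi) (le_of_abs_le hi)).trans_eq ?_⟩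
    field_simp
  rw [integral_const_mul] at hgrid
  calc (N : ℝ) ^ 2 * distortion μ x
      ≤ (3 * m) ^ 2 * (1 / (m : ℝ) ^ 2 * ∫ ξ, (1 + |ξ|) ^ 4 ∂μ) := by
        gcongr
        · exact distortion_nonneg μ x
        · exact_mod_cast hNm
        · exact (hx.minimal y).trans hgrid
    _ = 9 * ∫ ξ, (1 + |ξ|) ^ 4 ∂μ := by field_simp; ring

/-! ### Subgradients of convex functions -/

/-- `c` selects a subgradient of `f : ℝ → ℝ` at every point. -/
def IsSubgradient (f c : ℝ → ℝ) : Prop :=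
  ∀ a b, c a * (b - a) ≤ f b - f a

theorem isSubgradient_rightDeriv {f : ℝ → ℝ} (hf : ConvexOn ℝ Set.univ f) :
    IsSubgradient f fun x => derivWithin f (Set.Ioi x) x := by
  intro a b
  have ha : a ∈ interior Set.univ := by simp
  rcases lt_trichotomy a b with hab | rfl | hba
  · have hslope := hf.rightDeriv_le_slope_of_mem_interior ha (Set.mem_univ b) hab
    rwa [slope_def_field, le_div_iff₀ (sub_pos.2 hab)] at hslope
  · simp
  · have hslope := (hf.slope_le_leftDeriv_of_mem_interior (Set.mem_univ b) ha hba).trans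
      (hf.leftDeriv_le_rightDeriv_of_mem_interior ha)
    rw [slope_def_field, div_le_iff₀ (sub_pos.2 hba)] at hslope
    linarith

namespace IsSubgradient

variable {f c : ℝ → ℝ}

theorem monotone (hc : IsSubgradient f c) : Monotone c := by
  intro a b hab
  rcases hab.eq_or_lt with rfl | hlt
  · rfl
  · exact le_of_mul_le_mul_right (by linarith [hc a b, hc b a]) (sub_pos.2 hlt)

theorem abs_sub_sub_mul_le (hc : IsSubgradient f c) (a b : ℝ) :
    |f b - f a - c a * (b - a)| ≤ |(c b - c a) * (b - a)| := by
  rw [abs_of_nonneg (by linarith [hc a b])]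
  exact le_trans (by linarith [hc b a]) (le_abs_self _)

theorem abs_le_mul_exp_abs (hc : IsSubgradient f c) {B : ℝ}
    (hf : ∀ x, |f x| ≤ B * Real.exp |x|) (x : ℝ) :
    |c x| ≤ B * (Real.exp 1 + 1) * Real.exp |x| := by
  have hB : 0 ≤ B := by simpa using (abs_nonneg (f 0)).trans (hf 0)
  have hshift {y : ℝ} (hy : |y| ≤ |x| + 1) : |f y| ≤ B * (Real.exp |x| * Real.exp 1) := by
    rw [← Real.exp_add]
    exact (hf y).trans (by gcongr)
  have hupper := hshift (abs_add_le x 1 |>.trans_eq (by simp))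
  have hlower := hshift (abs_sub x 1 |>.trans_eq (by simp))
  rw [abs_le] at hupper hlower ⊢
  constructor <;> linarith [hc x (x + 1), hc x (x - 1), abs_le.1 (hf x)]

end IsSubgradient

/-! ### The weak error of optimal quantization for convex functions -/

theorem integral_abs_mul_le_sqrt_mul_sqrt {α : Type*} [MeasurableSpace α] {μ : Measure α}
    {u v : α → ℝ} (hu : MemLp u 2 μ) (hv : MemLp v 2 μ) :
    ∫ a, |u a * v a| ∂μ ≤ √(∫ a, u a ^ 2 ∂μ) * √(∫ a, v a ^ 2 ∂μ) := by
  have hu' : MemLp (fun a => |u a|) 2 μ := hu.abs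
  have hv' : MemLp (fun a => |v a|) 2 μ := hv.abs
  have hholder := integral_mul_le_Lp_mul_Lq_of_nonneg (μ := μ) Real.HolderConjugate.two_two
    (.of_forall fun a => abs_nonneg (u a)) (.of_forall fun a => abs_nonneg (v a))
    (by simpa using hu') (by simpa using hv')
  simpa only [abs_mul, Real.rpow_two, ← Real.sqrt_eq_rpow, sq_abs] using hholder

theorem IsOptimalQuantizer.abs_integral_sub_integral_voronoiProj_le {μ : Measure ℝ}
    [IsFiniteMeasure μ] {N : ℕ} {x : Fin N → ℝ} {C : Fin N → Set ℝ} (hx : IsOptimalQuantizer μ x)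
    (hC : IsVoronoiPartition x C) (hμ : MemLp (fun ξ : ℝ => ξ) 2 μ) {f c : ℝ → ℝ}
    (hf : Integrable f μ) (hc : MemLp c 2 μ) (hfc : IsSubgradient f c) :
    |∫ ξ, f ξ ∂μ - ∫ ξ, f (voronoiProj x C ξ) ∂μ|
      ≤ √(∫ ξ, (c ξ - c (voronoiProj x C ξ)) ^ 2 ∂μ) * √(distortion μ x) := by
  have hsub := hC.memLp_sub_voronoiProj hμ
  have hcomp := hC.memLp_comp_voronoiProj (μ := μ) c 2
  have hfπ : Integrable (fun ξ => f (voronoiProj x C ξ)) μ :=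
    (hC.memLp_comp_voronoiProj f 1).integrable le_rfl
  have hstat := hx.integral_comp_mul_sub_eq_zero hC hμ c
  rw [hC.distortion_eq]
  set π := voronoiProj x C
  have hdiff : Integrable (fun ξ => f ξ - f (π ξ)) μ := hf.sub hfπ
  have hlin : Integrable (fun ξ => c (π ξ) * (ξ - π ξ)) μ := hcomp.integrable_mul hsub
  have hprod : Integrable (fun ξ => (c ξ - c (π ξ)) * (ξ - π ξ)) μ :=
    (hc.sub hcomp).integrable_mul hsub
  calc |∫ ξ, f ξ ∂μ - ∫ ξ, f (π ξ) ∂μ|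
      = |∫ ξ, (f ξ - f (π ξ) - c (π ξ) * (ξ - π ξ)) ∂μ| := by
        rw [integral_sub hdiff hlin, hstat, sub_zero, integral_sub hf hfπ]
    _ ≤ ∫ ξ, |f ξ - f (π ξ) - c (π ξ) * (ξ - π ξ)| ∂μ := abs_integral_le_integral_abs
    _ ≤ ∫ ξ, |(c ξ - c (π ξ)) * (ξ - π ξ)| ∂μ :=
        integral_mono (hdiff.sub hlin).abs hprod.abs fun ξ => hfc.abs_sub_sub_mul_le (π ξ) ξ
    _ ≤ _ := integral_abs_mul_le_sqrt_mul_sqrt (hc.sub hcomp) hsub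

section ExpMoment

variable {μ : Measure ℝ}

theorem integrable_one_add_abs_pow {n : ℕ}
    (hμ : Integrable (fun ξ : ℝ => Real.exp (n * |ξ|)) μ) :
    Integrable (fun ξ : ℝ => (1 + |ξ|) ^ n) μ := by
  refine hμ.mono' (by fun_prop) (.of_forall fun ξ => ?_)
  rw [Real.norm_of_nonneg (by positivity), Real.exp_nat_mul, add_comm]
  gcongr
  exact Real.add_one_le_exp _

theorem memLp_of_abs_le_mul_exp_abs {n : ℕ} (hn : n ≠ 0)
    (hμ : Integrable (fun ξ : ℝ => Real.exp (n * |ξ|)) μ) {c : ℝ → ℝ} {B : ℝ}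
    (hc : AEStronglyMeasurable c μ) (hB : ∀ x, |c x| ≤ B * Real.exp |x|) : MemLp c n μ := by
  have hexp : MemLp (fun ξ : ℝ => Real.exp |ξ|) n μ := by
    rw [← integrable_norm_rpow_iff (by fun_prop) (by simpa using hn) (by simp)]
    simpa [← Real.exp_nat_mul] using hμ
  exact (hexp.const_mul B).mono' hc (.of_forall hB)

end ExpMoment

section Convergence

variable {μ : Measure ℝ} {Γ : (N : ℕ) → Fin N → ℝ} {C : (N : ℕ) → Fin N → Set ℝ}

theorem tendsto_distortion_zero (hμ : Integrable (fun ξ : ℝ => (1 + |ξ|) ^ 4) μ)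
    (hΓ : ∀ N, 1 ≤ N → IsOptimalQuantizer μ (Γ N)) :
    Tendsto (fun N => distortion μ (Γ N)) atTop (𝓝 0) := by
  set I := ∫ ξ, (1 + |ξ|) ^ 4 ∂μ
  have hlim : Tendsto (fun N : ℕ => 9 * I / (N : ℝ) ^ 2) atTop (𝓝 0) :=
    tendsto_const_nhds.div_atTop
      ((tendsto_pow_atTop two_ne_zero).comp tendsto_natCast_atTop_atTop)
  refine squeeze_zero' (.of_forall fun N => distortion_nonneg μ (Γ N)) ?_ hlim
  filter_upwards [eventually_ge_atTop 2] with N hN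
  have hN₀ : (0 : ℝ) < N := by exact_mod_cast (by omega : 0 < N)
  rw [le_div_iff₀' (pow_pos hN₀ 2)]
  exact (hΓ N (by omega)).sq_mul_distortion_le hμ hN

variable [IsFiniteMeasure μ]

theorem tendsto_voronoiProj (hμ : MemLp (fun ξ : ℝ => ξ) 2 μ)
    (hC : ∀ N, 1 ≤ N → IsVoronoiPartition (Γ N) (C N))
    (hD : Tendsto (fun N => distortion μ (Γ N)) atTop (𝓝 0)) {ξ : ℝ} (hξ : ξ ∈ μ.support) :
    Tendsto (fun N => voronoiProj (Γ N) (C N) ξ) atTop (𝓝 ξ) := by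
  rw [Metric.tendsto_nhds]
  intro ε hε
  have hball : 0 < μ.real (Metric.ball ξ (ε / 2)) :=
    ENNReal.toReal_pos ((Measure.mem_support_iff_forall ξ).1 hξ _
      (Metric.ball_mem_nhds ξ (half_pos hε))).ne' (measure_ne_top _ _)
  have hpos : 0 < (ε / 2) ^ 2 * μ.real (Metric.ball ξ (ε / 2)) := by positivity
  filter_upwards [hD.eventually_lt_const hpos, eventually_ge_atTop 1] with N hN h1
  by_contra! hfar
  rw [dist_comm, Real.dist_eq] at hfar
  exact hN.not_ge ((hC N h1).sq_mul_measureReal_ball_le_distortion hμ (half_pos hε).le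
    (by linarith))

/-- One support point near which the grids have points makes the projections grow at most linearly,
which provides the dominating function. -/
theorem exists_eventually_sub_comp_voronoiProj_sq_le (hμ : MemLp (fun ξ : ℝ => ξ) 2 μ) (hμ₀ : μ ≠ 0)
    (hC : ∀ N, 1 ≤ N → IsVoronoiPartition (Γ N) (C N))
    (hD : Tendsto (fun N => distortion μ (Γ N)) atTop (𝓝 0)) {c : ℝ → ℝ} {B : ℝ}
    (hB : ∀ x, |c x| ≤ B * Real.exp |x|) :
    ∃ A, ∀ᶠ N in atTop, ∀ ξ,
      (c ξ - c (voronoiProj (Γ N) (C N) ξ)) ^ 2 ≤ A * Real.exp (4 * |ξ|) := by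
  obtain ⟨a, ha⟩ := Measure.nonempty_support hμ₀
  have hbdd : ∀ᶠ N in atTop, |voronoiProj (Γ N) (C N) a| < |a| + 1 :=
    (tendsto_voronoiProj hμ hC hD ha).abs.eventually_lt_const (lt_add_one _)
  have hB₀ : 0 ≤ B := by simpa using (abs_nonneg (c 0)).trans (hB 0)
  refine ⟨(2 * B * Real.exp (|a| + 1)) ^ 2, ?_⟩
  filter_upwards [hbdd, eventually_ge_atTop 1] with N hN h1 ξ
  set π := voronoiProj (Γ N) (C N) ξ
  have hc {y : ℝ} (hy : |y| ≤ |a| + 1 + 2 * |ξ|) :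
      |c y| ≤ B * (Real.exp (|a| + 1) * Real.exp (2 * |ξ|)) := by
    rw [← Real.exp_add]
    exact (hB y).trans (by gcongr)
  have hcξ := hc (y := ξ) (by linarith [abs_nonneg a, abs_nonneg ξ])
  have hcπ := hc (y := π) (by linarith [(hC N h1).abs_voronoiProj_le ξ a])
  calc (c ξ - c π) ^ 2 = |c ξ - c π| ^ 2 := (sq_abs _).symm
    _ ≤ (2 * B * Real.exp (|a| + 1) * Real.exp (2 * |ξ|)) ^ 2 := by
        gcongr
        linarith [abs_sub (c ξ) (c π)]
    _ = (2 * B * Real.exp (|a| + 1)) ^ 2 * Real.exp (4 * |ξ|) := by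
        rw [mul_pow _ (Real.exp (2 * |ξ|)), ← Real.exp_nat_mul (2 * |ξ|)]
        ring_nf

theorem tendsto_integral_sub_comp_voronoiProj_sq [NullSingletonClass μ]
    (hexp : Integrable (fun ξ : ℝ => Real.exp (4 * |ξ|)) μ) (hμ : MemLp (fun ξ : ℝ => ξ) 2 μ)
    (hC : ∀ N, 1 ≤ N → IsVoronoiPartition (Γ N) (C N))
    (hD : Tendsto (fun N => distortion μ (Γ N)) atTop (𝓝 0)) {c : ℝ → ℝ} (hc : Monotone c) {B : ℝ}
    (hB : ∀ x, |c x| ≤ B * Real.exp |x|) :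
    Tendsto (fun N => ∫ ξ, (c ξ - c (voronoiProj (Γ N) (C N) ξ)) ^ 2 ∂μ) atTop (𝓝 0) := by
  rcases eq_or_ne μ 0 with rfl | hμ₀
  · simp
  obtain ⟨A, hA⟩ := exists_eventually_sub_comp_voronoiProj_sq_le hμ hμ₀ hC hD hB
  rw [← integral_zero ℝ ℝ (μ := μ)]
  refine tendsto_integral_filter_of_dominated_convergence (fun ξ => A * Real.exp (4 * |ξ|)) ?_ ?_
    (hexp.const_mul A) ?_
  · filter_upwards [eventually_ge_atTop 1] with N h1
    exact ((hc.measurable.sub ((hC N h1).measurable_comp_voronoiProj c)).pow_const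
      2).aestronglyMeasurable
  · filter_upwards [hA] with N hN
    exact .of_forall fun ξ => (Real.norm_of_nonneg (sq_nonneg _)).trans_le (hN ξ)
  · have hcont : ∀ᵐ ξ ∂μ, ContinuousAt c ξ := hc.countable_not_continuousAt.measure_zero μ
    filter_upwards [Measure.support_mem_ae (μ := μ), hcont] with ξ hξ hcξ
    simpa using ((hcξ.tendsto.comp (tendsto_voronoiProj hμ hC hD hξ)).const_sub (c ξ)).pow 2

theorem tendsto_mul_abs_integral_sub_integral_voronoiProj [NullSingletonClass μ]
    (hexp : Integrable (fun ξ : ℝ => Real.exp (4 * |ξ|)) μ)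
    (hΓ : ∀ N, 1 ≤ N → IsOptimalQuantizer μ (Γ N))
    (hC : ∀ N, 1 ≤ N → IsVoronoiPartition (Γ N) (C N)) {f : ℝ → ℝ}
    (hf : ConvexOn ℝ Set.univ f) {B : ℝ} (hB : ∀ x, |f x| ≤ B * Real.exp |x|) :
    Tendsto (fun N : ℕ => (N : ℝ) * |∫ ξ, f ξ ∂μ - ∫ ξ, f (voronoiProj (Γ N) (C N) ξ) ∂μ|)
      atTop (𝓝 0) := by
  have hsubg := isSubgradient_rightDeriv hf
  set c : ℝ → ℝ := fun x => derivWithin f (Set.Ioi x) x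
  have hcB := hsubg.abs_le_mul_exp_abs hB
  have hpow : Integrable (fun ξ : ℝ => (1 + |ξ|) ^ 4) μ :=
    integrable_one_add_abs_pow (by exact_mod_cast hexp)
  have hL4 {u : ℝ → ℝ} {A : ℝ} (hu : Measurable u) (hA : ∀ x, |u x| ≤ A * Real.exp |x|) :
      MemLp u 4 μ := by
    exact_mod_cast memLp_of_abs_le_mul_exp_abs (n := 4) (by norm_num) (by exact_mod_cast hexp)
      hu.aestronglyMeasurable hA
  have hid : MemLp (fun ξ : ℝ => ξ) 2 μ :=
    (hL4 (A := 1) measurable_id' fun x => by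
      linarith [Real.add_one_le_exp |x|]).mono_exponent (by norm_num)
  have hcL2 : MemLp c 2 μ := (hL4 hsubg.monotone.measurable hcB).mono_exponent (by norm_num)
  have hfL1 : Integrable f μ :=
    (hL4 (continuousOn_univ.1 (hf.continuousOn isOpen_univ)).measurable hB).integrable (by norm_num)
  have hslope := tendsto_integral_sub_comp_voronoiProj_sq hexp hid hC
    (tendsto_distortion_zero hpow hΓ) hsubg.monotone hcB
  set I := ∫ ξ, (1 + |ξ|) ^ 4 ∂μ
  have hlim : Tendsto (fun N => √(∫ ξ, (c ξ - c (voronoiProj (Γ N) (C N) ξ)) ^ 2 ∂μ) * √(9 * I))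
      atTop (𝓝 0) := by
    simpa using hslope.sqrt.mul_const √(9 * I)
  refine squeeze_zero' (.of_forall fun N => by positivity) ?_ hlim
  filter_upwards [eventually_ge_atTop 2] with N hN
  have hΓN := hΓ N (by omega)
  calc (N : ℝ) * |∫ ξ, f ξ ∂μ - ∫ ξ, f (voronoiProj (Γ N) (C N) ξ) ∂μ|
      ≤ N * (√(∫ ξ, (c ξ - c (voronoiProj (Γ N) (C N) ξ)) ^ 2 ∂μ) * √(distortion μ (Γ N))) := by
        gcongr
        exact hΓN.abs_integral_sub_integral_voronoiProj_le (hC N (by omega)) hid hfL1 hcL2 hsubg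
    _ = √(∫ ξ, (c ξ - c (voronoiProj (Γ N) (C N) ξ)) ^ 2 ∂μ)
          * √((N : ℝ) ^ 2 * distortion μ (Γ N)) := by
        rw [Real.sqrt_mul (by positivity), Real.sqrt_sq (by positivity)]
        ring
    _ ≤ _ := mul_le_mul_of_nonneg_left
        (Real.sqrt_le_sqrt (hΓN.sq_mul_distortion_le hpow hN)) (Real.sqrt_nonneg _)

end Convergence

/-! ### Densities with an exponential moment -/

section Density

variable {g : ℝ → ℝ}

theorem integral_densityLaw (hg : Measurable g) (hg₀ : ∀ x, 0 ≤ g x) (f : ℝ → ℝ) :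
    ∫ x, f x ∂densityLaw g = ∫ x, f x * g x := by
  rw [densityLaw, integral_withDensity_eq_integral_toReal_smul (by fun_prop) (by simp)]
  simp [ENNReal.toReal_ofReal (hg₀ _), mul_comm]

theorem integrable_densityLaw_iff (hg : Measurable g) (hg₀ : ∀ x, 0 ≤ g x) {f : ℝ → ℝ} :
    Integrable f (densityLaw g) ↔ Integrable fun x => f x * g x := by
  rw [densityLaw, integrable_withDensity_iff (by fun_prop) (by simp)]
  simp [ENNReal.toReal_ofReal (hg₀ _)]

theorem integrable_of_integrable_exp_mul_abs_mul {a : ℝ} (ha : 0 ≤ a) (hg : Measurable g)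
    (hexp : Integrable fun x => Real.exp (a * |x|) * g x) : Integrable g := by
  refine hexp.mono hg.aestronglyMeasurable (.of_forall fun x => ?_)
  rw [norm_mul, Real.norm_of_nonneg (Real.exp_pos _).le]
  exact le_mul_of_one_le_left (norm_nonneg _) (Real.one_le_exp (by positivity))

theorem lintegral_inter_Ioi_eq_lintegral_exp (F : ℝ → ℝ≥0∞) {s : Set ℝ} (hs : MeasurableSet s) :
    ∫⁻ y in s ∩ Set.Ioi 0, F y
      = ∫⁻ x in Real.exp ⁻¹' s, ENNReal.ofReal (Real.exp x) * F (Real.exp x) := by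
  have hsubst := lintegral_image_eq_lintegral_abs_deriv_mul (Real.measurable_exp hs)
    (fun x _ => (Real.hasDerivAt_exp x).hasDerivWithinAt) Real.exp_injective.injOn F
  simpa only [Set.image_preimage_eq_inter_range, Real.range_exp, Real.abs_exp] using hsubst

theorem map_exp_densityLaw (g : ℝ → ℝ) :
    (densityLaw g).map Real.exp = (volume.restrict (Set.Ioi 0)).withDensity
      fun s => ENNReal.ofReal (expDensity g s) := by
  ext s hs
  rw [Measure.map_apply Real.measurable_exp hs, densityLaw,
    withDensity_apply _ (Real.measurable_exp hs), withDensity_apply _ hs,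
    Measure.restrict_restrict hs, lintegral_inter_Ioi_eq_lintegral_exp _ hs]
  refine lintegral_congr fun x => ?_
  rw [expDensity, Real.log_exp, ← ENNReal.ofReal_mul (Real.exp_pos x).le,
    mul_div_cancel₀ _ (Real.exp_pos x).ne']

theorem integrable_exp_neg_mul_abs {b : ℝ} (hb : 0 < b) :
    Integrable fun x : ℝ => Real.exp (-b * |x|) := by
  rw [← integrableOn_univ, ← Set.Iic_union_Ioi (a := 0), integrableOn_union]
  constructor
  · refine (integrableOn_exp_mul_Iic hb 0).congr_fun (fun x hx => ?_) measurableSet_Iic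
    simp [abs_of_nonpos hx.out]
  · refine (integrableOn_exp_mul_Ioi (neg_neg_of_pos hb) 0).congr_fun (fun x hx => ?_)
      measurableSet_Ioi
    simp [abs_of_pos hx.out]

theorem exp_mul_abs_expDensity_rpow_le (g : ℝ → ℝ) (a x : ℝ) :
    Real.exp x * |expDensity g (Real.exp x)| ^ (1 / 3 : ℝ)
      ≤ |Real.exp (a * |x|) * g x| + Real.exp (-(a / 2 - 1) * |x|) := by
  have hgm := Real.geom_mean_le_arith_mean2_weighted (by norm_num : (0 : ℝ) ≤ 1 / 3)
    (by norm_num : (0 : ℝ) ≤ 2 / 3) (abs_nonneg (Real.exp (a * |x|) * g x))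
    (Real.exp_pos (x - a / 2 * |x|)).le (by norm_num)
  have hfactor : Real.exp x * |expDensity g (Real.exp x)| ^ (1 / 3 : ℝ)
      = |Real.exp (a * |x|) * g x| ^ (1 / 3 : ℝ) * Real.exp (x - a / 2 * |x|) ^ (2 / 3 : ℝ) := by
    rw [expDensity, Real.log_exp, abs_div, abs_mul, Real.abs_exp, Real.abs_exp, div_eq_mul_inv,
      ← Real.exp_neg, Real.mul_rpow (abs_nonneg _) (Real.exp_pos _).le,
      Real.mul_rpow (Real.exp_pos _).le (abs_nonneg _), ← Real.exp_mul, ← Real.exp_mul,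
      ← Real.exp_mul, mul_left_comm, ← Real.exp_add, mul_right_comm, ← Real.exp_add, mul_comm]
    ring_nf
  have hexp : Real.exp (x - a / 2 * |x|) ≤ Real.exp (-(a / 2 - 1) * |x|) :=
    Real.exp_le_exp.2 (by linarith [le_abs_self x])
  linarith [abs_nonneg (Real.exp (a * |x|) * g x), Real.exp_pos (x - a / 2 * |x|)]

theorem memLp_expDensity {a : ℝ} (ha : 2 < a) (hg : Measurable g)
    (hexp : Integrable fun x => Real.exp (a * |x|) * g x) :
    MemLp (expDensity g) (1 / 3) (volume.restrict (Set.Ioi 0)) := by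
  have hmeas : Measurable (expDensity g) := (hg.comp Real.measurable_log).div measurable_id
  have hbound : Integrable fun x => |Real.exp (a * |x|) * g x| + Real.exp (-(a / 2 - 1) * |x|) :=
    hexp.abs.add (integrable_exp_neg_mul_abs (by linarith))
  refine ⟨hmeas.aestronglyMeasurable, ?_⟩
  rw [eLpNorm_lt_top_iff_lintegral_rpow_enorm_lt_top (by simp) (by simp),
    ← Set.univ_inter (Set.Ioi (0 : ℝ)), lintegral_inter_Ioi_eq_lintegral_exp _ .univ,
    Set.preimage_univ, Measure.restrict_univ]
  refine (lintegral_mono fun x => ?_).trans_lt hbound.lintegral_lt_top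
  have hthird : (1 / 3 : ℝ≥0∞).toReal = 1 / 3 := by simp
  rw [hthird, Real.enorm_eq_ofReal_abs, ENNReal.ofReal_rpow_of_nonneg (abs_nonneg _) (by norm_num),
    ← ENNReal.ofReal_mul (Real.exp_pos x).le]
  exact ENNReal.ofReal_le_ofReal (exp_mul_abs_expDensity_rpow_le g a x)

end Density

/-! ### The quantization error of a call price -/

/-- The payoff of the call with strike `K`, as a function of the log price. -/
noncomputable def callPayoff (K x : ℝ) : ℝ := max (Real.exp x - K) 0

theorem convexOn_callPayoff (K : ℝ) : ConvexOn ℝ Set.univ (callPayoff K) :=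
  (convexOn_exp.sub (concaveOn_const K convex_univ)).sup (convexOn_const 0 convex_univ)

theorem abs_callPayoff_le (K x : ℝ) : |callPayoff K x| ≤ (1 + |K|) * Real.exp |x| := by
  have hx : Real.exp x ≤ Real.exp |x| := Real.exp_le_exp.2 (le_abs_self x)
  have hK : |K| ≤ |K| * Real.exp |x| :=
    le_mul_of_one_le_right (abs_nonneg K) (Real.one_le_exp (abs_nonneg x))
  rw [callPayoff, abs_of_nonneg (le_max_right _ _)]
  exact max_le (by linarith [neg_abs_le K]) (by positivity)

theorem quantError_eq {g : ℝ → ℝ} (hg : Measurable g) (hint : Integrable g) (hg₀ : ∀ x, 0 ≤ g x)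
    (r T K : ℝ) {N : ℕ} {x : Fin N → ℝ} {C : Fin N → Set ℝ} (hC : IsVoronoiPartition x C) :
    quantError r T K g x C = Real.exp (-r * T) * |∫ ξ, callPayoff K ξ ∂densityLaw g
      - ∫ ξ, callPayoff K (voronoiProj x C ξ) ∂densityLaw g| := by
  rw [integral_densityLaw hg hg₀, integral_densityLaw hg hg₀,
    ← hC.sum_setIntegral_mul_eq hint (callPayoff K), ← Real.abs_exp (-r * T), ← abs_mul, mul_sub]
  rfl

theorem tendsto_mul_quantError {g : ℝ → ℝ} (hg : Measurable g) (hg₀ : ∀ x, 0 ≤ g x)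
    (hexp : Integrable fun x => Real.exp (4 * |x|) * g x) (r T K : ℝ)
    {Γ : (N : ℕ) → Fin N → ℝ} {C : (N : ℕ) → Fin N → Set ℝ}
    (hΓ : ∀ N, 1 ≤ N → IsOptimalQuantizer (densityLaw g) (Γ N))
    (hC : ∀ N, 1 ≤ N → IsVoronoiPartition (Γ N) (C N)) :
    Tendsto (fun N : ℕ => (N : ℝ) * quantError r T K g (Γ N) (C N)) atTop (𝓝 0) := by
  have hint := integrable_of_integrable_exp_mul_abs_mul (by norm_num) hg hexp
  have : IsFiniteMeasure (densityLaw g) := isFiniteMeasure_withDensity_ofReal hint.2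
  have : NullSingletonClass (densityLaw g) := by
    unfold densityLaw
    infer_instance
  have hweak := (tendsto_mul_abs_integral_sub_integral_voronoiProj
    ((integrable_densityLaw_iff hg hg₀).2 hexp) hΓ hC (convexOn_callPayoff K)
    (abs_callPayoff_le K)).const_mul (Real.exp (-r * T))
  rw [mul_zero] at hweak
  refine hweak.congr' ?_
  filter_upwards [eventually_ge_atTop 1] with N hN
  rw [quantError_eq hg hint hg₀ r T K (hC N hN), mul_left_comm]

/-! ### Polynomial multiples of the Gaussian density -/

theorem integrable_exp_mul_abs_mul_eval_gaussianReal (m : ℝ) (v : ℝ≥0) (a : ℝ)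
    (q : Polynomial ℝ) :
    Integrable (fun x => Real.exp (a * |x|) * q.eval x) (gaussianReal m v) := by
  induction q using Polynomial.induction_on' with
  | add p q hp hq =>
    simp only [Polynomial.eval_add, mul_add]
    exact hp.add hq
  | monomial n b =>
    have hpow : Integrable (fun x : ℝ => |x| ^ n * Real.exp (0 * x + |a| * |x|))
        (gaussianReal m v) :=
      integrable_pow_abs_mul_exp_add_of_integrable_exp_mul (t := |a| + 1)
        (integrable_exp_mul_gaussianReal _) (integrable_exp_mul_gaussianReal _) (abs_nonneg a)
        ((lt_add_one _).trans_le (le_abs_self _)) n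
    refine (hpow.const_mul |b|).mono' (by fun_prop) (.of_forall fun x => ?_)
    rw [Polynomial.eval_monomial, norm_mul, norm_mul, norm_pow, Real.norm_eq_abs b,
      Real.norm_eq_abs x, Real.norm_of_nonneg (Real.exp_pos _).le, mul_comm, mul_assoc, zero_mul,
      zero_add]
    gcongr
    exact le_abs_self a

theorem integrable_exp_mul_abs_mul_eval_mul_weight (m : ℝ) {s : ℝ≥0} (hs : s ≠ 0) (a : ℝ)
    (q : Polynomial ℝ) : Integrable fun x => Real.exp (a * |x|) * (q.eval x * weight m s x) := by
  have hgauss := integrable_exp_mul_abs_mul_eval_gaussianReal m (s ^ 2) a q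
  rw [gaussianReal_of_var_ne_zero m (pow_ne_zero 2 hs),
    integrable_withDensity_iff (measurable_gaussianPDF m _)
      (.of_forall fun _ => gaussianPDF_lt_top)] at hgauss
  simpa only [toReal_gaussianPDF, mul_assoc] using! hgauss

theorem exists_polynomial_genHermite_eq_eval (m : ℝ) (s : ℝ≥0) (n : ℕ) :
    ∃ q : Polynomial ℝ, ∀ x, genHermite m s n x = q.eval x := by
  refine ⟨.C (1 / √(n.factorial : ℝ)) * ((Polynomial.hermite n).map (algebraMap ℤ ℝ)).comp
    (.C (s : ℝ)⁻¹ * (.X - .C m)), fun x => ?_⟩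
  rw [genHermite, Polynomial.aeval_def, ← Polynomial.eval_map]
  simp [div_eq_inv_mul]

section TruncDensity

variable {Ω : Type*} [MeasurableSpace Ω] (P : Measure Ω) (Y : Ω → ℝ) (m : ℝ) (M : ℕ)

theorem exists_polynomial_truncDensity_eq (s : ℝ≥0) :
    ∃ q : Polynomial ℝ, ∀ x, truncDensity P Y m s M x = q.eval x * weight m s x := by
  choose q hq using exists_polynomial_genHermite_eq_eval m s
  refine ⟨∑ n ∈ Finset.range (M + 1), .C (hermiteMoment P Y m s n) * q n, fun x => ?_⟩
  simp only [truncDensity, hq, Polynomial.eval_finsetSum, Polynomial.eval_mul, Polynomial.eval_C,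
    Finset.sum_mul]

theorem measurable_truncDensity (s : ℝ≥0) : Measurable (truncDensity P Y m s M) := by
  obtain ⟨q, hq⟩ := exists_polynomial_truncDensity_eq P Y m M s
  rw [funext hq]
  exact q.continuous.measurable.mul (measurable_gaussianPDFReal m (s ^ 2))

theorem integrable_exp_mul_abs_mul_truncDensity {s : ℝ≥0} (hs : s ≠ 0) (a : ℝ) :
    Integrable fun x => Real.exp (a * |x|) * truncDensity P Y m s M x := by
  obtain ⟨q, hq⟩ := exists_polynomial_truncDensity_eq P Y m M s
  simpa only [hq] using integrable_exp_mul_abs_mul_eval_mul_weight m hs a q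

end TruncDensity

end SVJ

theorem theorem4p4_general {g : ℝ → ℝ} (hg : Measurable g) (hg₀ : ∀ x, 0 ≤ g x)
    (hexp : Integrable fun x => Real.exp (4 * |x|) * g x) (r T K : ℝ)
    {Γ : (N : ℕ) → Fin N → ℝ} {C : (N : ℕ) → Fin N → Set ℝ}
    (hΓ : ∀ N, 1 ≤ N → SVJ.IsOptimalQuantizer (SVJ.densityLaw g) (Γ N))
    (hC : ∀ N, 1 ≤ N → SVJ.IsVoronoiPartition (Γ N) (C N)) :
    (SVJ.densityLaw g).map Real.exp = (volume.restrict (Set.Ioi 0)).withDensity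
        (fun s => ENNReal.ofReal (SVJ.expDensity g s)) ∧
    MemLp (SVJ.expDensity g) (1 / 3) (volume.restrict (Set.Ioi 0)) ∧
    Tendsto (fun N : ℕ => (N : ℝ) * SVJ.quantError r T K g (Γ N) (C N)) atTop (𝓝 0) :=
  ⟨SVJ.map_exp_densityLaw g, SVJ.memLp_expDensity (by norm_num) hg hexp,
    SVJ.tendsto_mul_quantError hg hg₀ hexp r T K hΓ hC⟩

theorem theorem4p4 {Ω : Type*} [mΩ : MeasurableSpace Ω] (P : Measure Ω) [IsProbabilityMeasure P]
    (p : SVJ.Params) (hp : p.Admissible) (T : ℝ) (hT : 0 < T)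
    (ℱ : Filtration (Set.Icc (0 : ℝ) T) mΩ) (V X : ℝ → Ω → ℝ)
    (hVX : SVJ.IsSolution p T ℱ P V X)
    (K μw : ℝ) (σw : ℝ≥0) (hσw : p.vmax * T / 2 < (σw : ℝ) ^ 2)
    (M : ℕ) (hM : 0 < M)
    (g h : ℝ → ℝ) (hg : g = SVJ.truncDensity P (X T) μw σw M) (hh : h = SVJ.expDensity g)
    (hg_nonneg : ∀ x, 0 ≤ g x)
    (Γ : (N : ℕ) → Fin N → ℝ) (C : (N : ℕ) → Fin N → Set ℝ)
    (hΓ : ∀ N, 1 ≤ N → SVJ.IsOptimalQuantizer (SVJ.densityLaw g) (Γ N))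
    (hC : ∀ N, 1 ≤ N → SVJ.IsVoronoiPartition (Γ N) (C N)) :
    (SVJ.densityLaw g).map Real.exp
        = (volume.restrict (Set.Ioi 0)).withDensity (fun s => ENNReal.ofReal (h s)) ∧
    MemLp h (1 / 3) (volume.restrict (Set.Ioi 0)) ∧
    ∃ L : ℝ,
      Tendsto (fun N : ℕ => (N : ℝ) * SVJ.quantError p.r T K g (Γ N) (C N)) atTop (𝓝 L) ∧
      L ≤ (eLpNorm h (1 / 3) (volume.restrict (Set.Ioi 0))).toReal ^ (1 / 2 : ℝ)
            / (2 * √3) := by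
  have hvmax : 0 < p.vmax := hp.vmin_pos.trans hp.vmin_lt_vmax
  have hσ : σw ≠ 0 := by
    rintro rfl
    rw [NNReal.coe_zero, zero_pow two_ne_zero] at hσw
    exact hσw.not_ge (by positivity)
  subst hg hh
  obtain ⟨hmap, hmem, hlim⟩ := theorem4p4_general (SVJ.measurable_truncDensity P (X T) μw M σw)
    hg_nonneg (SVJ.integrable_exp_mul_abs_mul_truncDensity P (X T) μw M hσ 4) p.r T K hΓ hC
  exact ⟨hmap, hmem, 0, hlim, by positivity⟩
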